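/- For a real $m\times n$ matrix $A=(a_{ij})$, its tropical linear prevariety is the set of all $x\in\mathbb{R}^n$ such that for every row $i$ the minimum $\min_{1\le j\le n}(a_{ij}+x_j)$ is attained for at least two different columns $j$. The (affine) tropical dimension of $A$ is the largest dimension of a polyhedron (solution set of finitely many non-strict linear inequalities) in $\mathbb{R}^n$ contained in the prevariety; it is taken to be $0$ if the prevariety is empty. A square matrix $M\in\mathbb{R}^{r\times r}$ is tropically singular if the minimum of $\sum_i M_{i\sigma(i)}$ over all permutations $\sigma$ of $\{1,\dots,r\}$ is attained by at least two permutations, and the tropical rank of $A$ is the largest $r$ such that $A$ has an $r\times r$ submatrix that is not tropically singular. Lemma. For any matrix $A\in\mathbb{R}^{m\times n}$, $$n-\text{tropical dimension}(A)\le\text{tropical rank}(A),$$ and the inequality can be both tight and strict. Namely, for $$A=\begin{pmatrix}1&0&0\\0&1&0\end{pmatrix}$$ the prevariety is $\{(c,c,c):c\in\mathbb{R}\}$, the tropical dimension is $1$ and the tropical rank is $2$, so that equality holds, and for $$A=\begin{pmatrix}0&0&0&0&0\\1&0&0&0&0\\1&1&0&0&0\\1&1&1&0&0\end{pmatrix}$$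 both the tropical dimension and the tropical rank are $4$, so that the inequality is strict ($5-4=1<4$). -/

import Mathlib

namespace TropicalLinear

/-- The tropical linear prevariety of a real `m × n` matrix `A`: the set of solutions
`x ∈ ℝⁿ` of the tropical linear system with matrix `A`, i.e. of those `x` for which in every row
the minimum of the numbers `A i j + x j` is attained in at least two different columns. -/
def prevariety {m n : ℕ} (A : Matrix (Fin m) (Fin n) ℝ) : Set (Fin n → ℝ) :=
  {x | ∀ i : Fin m, ∃ k l : Fin n, k < l ∧
    A i k + x k = A i l + x l ∧ ∀ j : Fin n, A i k + x k ≤ A i j + x j}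

/-- A (closed, convex) polyhedron in `ℝⁿ`: the solution set of finitely many non-strict linear
inequalities. -/
def IsPolyhedron {n : ℕ} (P : Set (Fin n → ℝ)) : Prop :=
  ∃ (k : ℕ) (B : Matrix (Fin k) (Fin n) ℝ) (c : Fin k → ℝ),
    P = {x | ∀ i : Fin k, (B.mulVec x) i ≤ c i}

/-- The dimension of a subset `P` of `ℝⁿ` (used for polyhedra): the dimension of its affine span,
with value `0` for the empty set. -/
noncomputable def affineDim {n : ℕ} (P : Set (Fin n → ℝ)) : ℕ :=
  Module.finrank ℝ (affineSpan ℝ P).direction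

/-- The (affine) tropical dimension of `A`: the largest dimension of a polyhedron contained in
the tropical linear prevariety of `A`, as a subset of `ℝⁿ`. It is `0` if the prevariety is empty
(the affine dimension is one more than the projective one, which is `-1` for the empty set). -/
noncomputable def tropicalDimension {m n : ℕ} (A : Matrix (Fin m) (Fin n) ℝ) : ℕ :=
  sSup {d | ∃ P : Set (Fin n → ℝ), IsPolyhedron P ∧ P ⊆ prevariety A ∧ affineDim P = d}

/-- A square matrix is tropically singular if the minimum over all permutations `σ` of
`∑ i, M i (σ i)` (its tropical determinant) is attained by at least two permutations. -/
def IsTropicallySingular {r : ℕ} (M : Matrix (Fin r) (Fin r) ℝ) : Prop :=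
  ∃ σ τ : Equiv.Perm (Fin r), σ ≠ τ ∧
    ∑ i, M i (σ i) = ∑ i, M i (τ i) ∧
    ∀ ρ : Equiv.Perm (Fin r), ∑ i, M i (σ i) ≤ ∑ i, M i (ρ i)

/-- The tropical rank of `A`: the largest `r` such that `A` has an `r × r` submatrix that is not
tropically singular. -/
noncomputable def tropicalRank {m n : ℕ} (A : Matrix (Fin m) (Fin n) ℝ) : ℕ :=
  sSup {r | ∃ (f : Fin r ↪ Fin m) (g : Fin r ↪ Fin n), ¬ IsTropicallySingular (A.submatrix f g)}

/-- The dimensions in the definition of `tropicalDimension` form a nonempty bounded set, so that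
the supremum there is a maximum. -/
theorem tropicalDimension_set {m n : ℕ} (A : Matrix (Fin m) (Fin n) ℝ) :
    Set.Nonempty {d | ∃ P : Set (Fin n → ℝ),
      IsPolyhedron P ∧ P ⊆ prevariety A ∧ affineDim P = d} ∧
    BddAbove {d | ∃ P : Set (Fin n → ℝ),
      IsPolyhedron P ∧ P ⊆ prevariety A ∧ affineDim P = d} := by
  refine ⟨⟨_, ∅, ⟨1, 0, fun _ => -1, ?_⟩, Set.empty_subset _, rfl⟩, n, ?_⟩
  · ext x
    simp only [Set.mem_empty_iff_false, Set.mem_ofPred_eq, false_iff, not_forall]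
    exact ⟨0, by simp⟩
  · rintro d ⟨P, -, -, rfl⟩
    exact (Submodule.finrank_le _).trans (by simp)

/-- The sizes in the definition of `tropicalRank` form a nonempty bounded set, so that the
supremum there is a maximum. -/
theorem tropicalRank_set {m n : ℕ} (A : Matrix (Fin m) (Fin n) ℝ) :
    Set.Nonempty {r | ∃ (f : Fin r ↪ Fin m) (g : Fin r ↪ Fin n),
      ¬ IsTropicallySingular (A.submatrix f g)} ∧
    BddAbove {r | ∃ (f : Fin r ↪ Fin m) (g : Fin r ↪ Fin n),
      ¬ IsTropicallySingular (A.submatrix f g)} := by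
  refine ⟨⟨0, ⟨Fin.elim0, fun a => a.elim0⟩, ⟨Fin.elim0, fun a => a.elim0⟩, ?_⟩, n, ?_⟩
  · rintro ⟨σ, τ, h, -⟩
    exact h (Subsingleton.elim _ _)
  · rintro r ⟨-, g, -⟩
    simpa using Fintype.card_le_of_embedding g

end TropicalLinear

/-! Let `r` be the tropical rank. Any `r + 1` columns carry a solution
(`exists_solution_of_tropicalRank_lt`): a system without one has a selection of distinct rows whose
square matrix has a unique optimal permutation (`exists_solution_or_exists_unique_optimum`). Apply
this to the first `r` columns together with each later column `k`, shift each solution to a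
prescribed value at `k`, and take pointwise minima: the prevariety projects onto all of the last `n
- r` coordinates (`exists_mem_prevariety_extending`). As a finite union of polyhedra, it has a piece
whose projection is not null, hence a piece of dimension at least `n - r`. -/

namespace TropicalLinear

/-! ### Solvability of tropical linear systems -/

section Solvability

variable {ι κ : Type*} [DecidableEq ι]

/-- The system restricted to the pairs `(i, j)` with `i ∈ F j`: in row `i`, column `j` is not the
unique minimizer. -/
def IsRestrictedSolution (A : κ → ι → ℝ) (F : ι → Finset κ) (x : ι → ℝ) : Prop :=
  ∀ j, ∀ i ∈ F j, ∃ k, k ≠ j ∧ A i k + x k ≤ A i j + x j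

/-- Solvability of two restricted systems which differ in a single column `j` implies solvability
of their union: normalize the solutions at `j` and take the pointwise minimum. -/
theorem exists_isRestrictedSolution_union [DecidableEq κ] (A : κ → ι → ℝ) (F : ι → Finset κ)
    (j : ι) (S T : Finset κ)
    (hS : ∃ x, IsRestrictedSolution A (Function.update F j S) x)
    (hT : ∃ x, IsRestrictedSolution A (Function.update F j T) x) :
    ∃ x, IsRestrictedSolution A (Function.update F j (S ∪ T)) x := by
  obtain ⟨x, hx⟩ := hS
  obtain ⟨y, hy⟩ := hT
  refine ⟨fun l => min (x l - x j) (y l - y j), fun l i hi => ?_⟩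
  have left : ∀ l i, i ∈ Function.update F j S l → x l - x j ≤ y l - y j →
      ∃ k, k ≠ l ∧ A i k + min (x k - x j) (y k - y j) ≤
        A i l + min (x l - x j) (y l - y j) := by
    intro l i hi hle
    obtain ⟨k, hk, h⟩ := hx l i hi
    refine ⟨k, hk, ?_⟩
    rw [min_eq_left hle]
    linarith [min_le_left (x k - x j) (y k - y j)]
  have right : ∀ l i, i ∈ Function.update F j T l → y l - y j ≤ x l - x j →
      ∃ k, k ≠ l ∧ A i k + min (x k - x j) (y k - y j) ≤
        A i l + min (x l - x j) (y l - y j) := by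
    intro l i hi hle
    obtain ⟨k, hk, h⟩ := hy l i hi
    refine ⟨k, hk, ?_⟩
    rw [min_eq_right hle]
    linarith [min_le_right (x k - x j) (y k - y j)]
  -- At `j` both normalized solutions vanish, so either can serve, according to whether the row
  -- comes from `S` or `T`. Elsewhere both systems impose the same constraints, and the smaller
  -- solution serves.
  by_cases hl : l = j
  · subst hl
    rw [Function.update_self, Finset.mem_union] at hi
    rcases hi with hi | hi
    · exact left l i (by simpa using hi) (by simp)
    · exact right l i (by simpa using hi) (by simp)
  · rw [Function.update_of_ne hl] at hi
    rcases le_total (x l - x j) (y l - y j) with h | h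
    · exact left l i (by simpa [hl] using hi) h
    · exact right l i (by simpa [hl] using hi) h

variable [Fintype ι]

/-- If the restricted system of every selection of one row per column is solvable, then so is every
restricted system. -/
theorem exists_isRestrictedSolution_of_selections [Nonempty κ] (A : κ → ι → ℝ)
    (h : ∀ σ : ι → κ, ∃ x, IsRestrictedSolution A (fun j => {σ j}) x) (F : ι → Finset κ) :
    ∃ x, IsRestrictedSolution A F x := by
  classical
  -- Induction on the set `s` of columns whose row set may fail to be a singleton.
  have key : ∀ (s : Finset ι) (F : ι → Finset κ), (∀ j ∉ s, ∃ i, F j = {i}) →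
      ∃ x, IsRestrictedSolution A F x := by
    intro s
    induction s using Finset.induction_on with
    | empty =>
      intro F hF
      choose σ hσ using fun j => hF j (Finset.notMem_empty j)
      rw [show F = fun j => {σ j} from funext hσ]
      exact h σ
    | insert j s hj ih =>
      intro F hF
      have single : ∀ i, ∃ x, IsRestrictedSolution A (Function.update F j {i}) x := by
        intro i
        refine ih _ fun l hl => ?_
        by_cases hlj : l = j
        · subst hlj
          exact ⟨i, by simp⟩
        · obtain ⟨i', hi'⟩ := hF l (by simp [hlj, hl])
          exact ⟨i', by simp [hlj, hi']⟩
      have all : ∀ S : Finset κ, ∃ x, IsRestrictedSolution A (Function.update F j S) x := by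
        intro S
        induction S using Finset.induction_on with
        | empty =>
          obtain ⟨x, hx⟩ := single (Classical.arbitrary κ)
          refine ⟨x, fun l i hi => hx l i ?_⟩
          by_cases hlj : l = j
          · subst hlj
            simp at hi
          · simpa [hlj] using hi
        | insert i S _ ih' =>
          rw [Finset.insert_eq]
          exact exists_isRestrictedSolution_union A F j _ _ (single i) ih'
      simpa using all (F j)
  exact key Finset.univ F (by simp)

/-- A permutation `τ ≠ 1` of nonpositive total weight yields a potential `x` such that every vertex
`j` has an outgoing edge to some `k ≠ j` with `w j k + x k ≤ x j`. -/
theorem exists_potential_of_sum_nonpos (w : ι → ι → ℝ) (hw : ∀ j, w j j = 0)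
    (τ : Equiv.Perm ι) (hτ : τ ≠ 1) (hsum : ∑ j, w j (τ j) ≤ 0) :
    ∃ x : ι → ℝ, ∀ j, ∃ k, k ≠ j ∧ w j k + x k ≤ x j := by
  classical
  -- Using `N` as a common period avoids individual cycle lengths: `W j` below is the weight of `N`
  -- steps along `τ` from `j`, a multiple of its cycle's weight.
  set N := orderOf τ with hN
  have hNpos : 0 < N := orderOf_pos τ
  have hNR : (0 : ℝ) < N := by exact_mod_cast hNpos
  set u : ι → ℕ → ℝ := fun j t => w ((τ ^ t) j) ((τ ^ (t + 1)) j) with hu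
  have u_zero : ∀ j, u j 0 = w j (τ j) := fun j => by simp [hu]
  have u_shift : ∀ j t, u (τ j) t = u j (t + 1) := fun j t => by
    simp only [hu, ← Equiv.Perm.mul_apply, ← pow_succ]
  have u_period : ∀ j, u j N = u j 0 := fun j => by
    simp only [hu, pow_succ, hN, pow_orderOf_eq_one, pow_zero]
  set W : ι → ℝ := fun j => ∑ t ∈ Finset.range N, u j t with hW
  have W_shift : ∀ j, W (τ j) = W j := fun j => by
    simp only [hW, u_shift]
    have := Finset.sum_range_succ (u j) N
    rw [Finset.sum_range_succ', u_period] at this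
    linarith
  have W_fixed : ∀ j, τ j = j → W j = 0 := fun j hj => by
    refine Finset.sum_eq_zero fun t _ => ?_
    have hp : ∀ t : ℕ, (τ ^ t) j = j := fun t => by
      induction t with
      | zero => simp
      | succ t ih => rw [pow_succ, Equiv.Perm.mul_apply, hj, ih]
    simp only [hu, hp, hw]
  have W_sum : ∑ j, W j ≤ 0 := by
    simp only [hW]
    rw [Finset.sum_comm]
    refine Finset.sum_nonpos fun t _ => ?_
    rw [← Equiv.sum_comp (τ ^ t) fun j => w j (τ j)] at hsum
    refine le_trans (le_of_eq (Finset.sum_congr rfl fun j _ => ?_)) hsum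
    simp only [hu, pow_succ', Equiv.Perm.mul_apply]
  -- Fixed points contribute zero, so the nontrivial cycles cannot all have positive weight.
  obtain ⟨c, hc, hWc⟩ : ∃ c, τ c ≠ c ∧ W c ≤ 0 := by
    by_contra! hcon
    obtain ⟨a, ha⟩ : ∃ a, τ a ≠ a := by
      by_contra! hfix
      exact hτ (Equiv.ext hfix)
    refine absurd W_sum (not_le.2 (Finset.sum_pos' (fun j _ => ?_) ⟨a, Finset.mem_univ a, hcon a ha⟩))
    by_cases hj : τ j = j
    · exact (W_fixed j hj).ge
    · exact (hcon j hj).le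
  -- The mean, over `m = 0, …, N - 1`, of the weight of the first `m` steps from `j`; advancing the
  -- start by one step telescopes up to `W j / N`.
  set y : ι → ℝ := fun j => (∑ t ∈ Finset.range N, ((N : ℝ) - 1 - t) * u j t) / N with hy
  have y_step : ∀ j, y j = w j (τ j) + y (τ j) - W j / N := fun j => by
    have h1 : ∑ t ∈ Finset.range N, ((N : ℝ) - 1 - t) * u (τ j) t
        = ∑ t ∈ Finset.range N, ((N : ℝ) - t) * u j t - N * u j 0 := by
      have := Finset.sum_range_succ (fun t : ℕ => ((N : ℝ) - t) * u j t) N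
      rw [Finset.sum_range_succ'] at this
      simp only [sub_self, zero_mul, add_zero, Nat.cast_zero, sub_zero] at this
      rw [← this, add_sub_cancel_right]
      refine Finset.sum_congr rfl fun t _ => ?_
      rw [u_shift]
      push_cast
      ring
    have h2 : ∑ t ∈ Finset.range N, ((N : ℝ) - t) * u j t
        = ∑ t ∈ Finset.range N, ((N : ℝ) - 1 - t) * u j t + W j := by
      simp only [hW]
      rw [← Finset.sum_add_distrib]
      exact Finset.sum_congr rfl fun t _ => by ring
    simp only [hy]
    rw [h1, h2, ← u_zero]
    field_simp
    ring
  -- On nontrivial cycles of nonpositive weight the edge is `j → τ j`; every other vertex points to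
  -- `c`.
  refine ⟨fun j => if τ j ≠ j ∧ W j ≤ 0 then y j else w j c + y c, fun j => ?_⟩
  by_cases hj : τ j ≠ j ∧ W j ≤ 0
  · refine ⟨τ j, hj.1, ?_⟩
    have hτj : τ (τ j) ≠ τ j ∧ W (τ j) ≤ 0 :=
      ⟨fun h => hj.1 (τ.injective h), (W_shift j).trans_le hj.2⟩
    simp only [if_pos hj, if_pos hτj]
    linarith [y_step j, div_nonpos_of_nonpos_of_nonneg hj.2 hNR.le]
  · refine ⟨c, fun h => hj (h ▸ ⟨hc, hWc⟩), ?_⟩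
    simp only [if_neg hj, if_pos (And.intro hc hWc), le_refl]

/-- A tropical linear system either has a solution or a selection of distinct rows, one per column,
such that the identity is the unique optimal permutation of the resulting square matrix. -/
theorem exists_solution_or_exists_unique_optimum (A : κ → ι → ℝ) [Fintype κ] :
    (∃ x : ι → ℝ, ∀ i j, ∃ k, k ≠ j ∧ A i k + x k ≤ A i j + x j) ∨
    ∃ σ : ι → κ, Function.Injective σ ∧
      ∀ τ : Equiv.Perm ι, τ ≠ 1 → ∑ j, A (σ j) j < ∑ j, A (σ j) (τ j) := by
  classical
  rcases isEmpty_or_nonempty κ with hκ | hκ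
  · exact Or.inl ⟨0, fun i => hκ.elim i⟩
  refine or_iff_not_imp_right.2 fun hno => ?_
  suffices h : ∀ σ : ι → κ, ∃ x, IsRestrictedSolution A (fun j => {σ j}) x by
    obtain ⟨x, hx⟩ := exists_isRestrictedSolution_of_selections A h fun _ => Finset.univ
    exact ⟨x, fun i j => hx j i (Finset.mem_univ i)⟩
  intro σ
  obtain ⟨τ, hτ, hle⟩ : ∃ τ : Equiv.Perm ι, τ ≠ 1 ∧
      ∑ j, A (σ j) (τ j) ≤ ∑ j, A (σ j) j := by
    by_contra! hcon
    refine hno ⟨σ, fun a b hab => ?_, hcon⟩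
    by_contra hne
    -- Two equal selected rows would let the transposition tie with the identity.
    refine absurd (hcon (Equiv.swap a b) (by simpa using hne)) (not_lt.2 (le_of_eq ?_))
    rw [← Equiv.sum_comp (Equiv.swap a b) fun j => A (σ j) j]
    refine Finset.sum_congr rfl fun j _ => ?_
    refine congrArg (fun i => A i (Equiv.swap a b j)) ?_
    rcases eq_or_ne j a with rfl | hja
    · rw [Equiv.swap_apply_left]
      exact hab
    rcases eq_or_ne j b with rfl | hjb
    · rw [Equiv.swap_apply_right]
      exact hab.symm
    · rw [Equiv.swap_apply_of_ne_of_ne hja hjb]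
  obtain ⟨x, hx⟩ := exists_potential_of_sum_nonpos (fun j k => A (σ j) k - A (σ j) j)
    (fun j => sub_self _) τ hτ (by rw [Finset.sum_sub_distrib]; linarith)
  refine ⟨x, fun j i hi => ?_⟩
  obtain rfl := Finset.mem_singleton.1 hi
  obtain ⟨k, hk, h⟩ := hx j
  exact ⟨k, hk, by linarith⟩

end Solvability

/-! ### Prevariety, rank and dimension: basic bounds -/

/-- A point lies in the prevariety as soon as no column is the unique minimizer of a row. -/
theorem mem_prevariety_of_forall_exists_ne {m n : ℕ} [NeZero n] {A : Matrix (Fin m) (Fin n) ℝ}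
    {x : Fin n → ℝ} (h : ∀ i j, ∃ k, k ≠ j ∧ A i k + x k ≤ A i j + x j) : x ∈ prevariety A := by
  intro i
  obtain ⟨k, hk⟩ := Finite.exists_min fun j => A i j + x j
  obtain ⟨l, hlk, hl⟩ := h i k
  have heq : A i k + x k = A i l + x l := le_antisymm (hk l) hl
  rcases lt_or_gt_of_ne hlk with hlt | hlt
  · exact ⟨l, k, hlt, heq.symm, fun j => heq ▸ hk j⟩
  · exact ⟨k, l, hlt, heq, hk⟩

theorem not_isTropicallySingular_of_unique_optimum {r : ℕ} {M : Matrix (Fin r) (Fin r) ℝ}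
    (h : ∀ τ : Equiv.Perm (Fin r), τ ≠ 1 → ∑ i, M i i < ∑ i, M i (τ i)) :
    ¬ IsTropicallySingular M := by
  rintro ⟨σ, τ, hne, heq, hmin⟩
  have hopt : ∀ ρ : Equiv.Perm (Fin r), ∑ i, M i (ρ i) ≤ ∑ i, M i i → ρ = 1 := fun ρ hρ => by
    by_contra hρ1
    exact absurd (h ρ hρ1) (not_lt.2 hρ)
  have hσ := hopt σ (hmin 1)
  exact hne (hσ.trans (hopt τ (heq ▸ hmin 1)).symm)

theorem le_tropicalRank {m n r : ℕ} {A : Matrix (Fin m) (Fin n) ℝ} (f : Fin r ↪ Fin m)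
    (g : Fin r ↪ Fin n) (h : ¬ IsTropicallySingular (A.submatrix f g)) : r ≤ tropicalRank A :=
  le_csSup (tropicalRank_set A).2 ⟨f, g, h⟩

theorem tropicalRank_le_rows {m n : ℕ} (A : Matrix (Fin m) (Fin n) ℝ) : tropicalRank A ≤ m := by
  refine csSup_le (tropicalRank_set A).1 ?_
  rintro r ⟨f, -, -⟩
  simpa using Fintype.card_le_of_embedding f

theorem affineDim_le_tropicalDimension {m n : ℕ} {A : Matrix (Fin m) (Fin n) ℝ}
    {P : Set (Fin n → ℝ)} (hP : IsPolyhedron P) (h : P ⊆ prevariety A) :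
    affineDim P ≤ tropicalDimension A :=
  le_csSup (tropicalDimension_set A).2 ⟨P, hP, h, rfl⟩

/-! ### Prescribing the coordinates beyond the rank -/

/-- More columns than the tropical rank carry a solution. -/
theorem exists_solution_of_tropicalRank_lt {m n s : ℕ} (A : Matrix (Fin m) (Fin n) ℝ)
    (g : Fin s ↪ Fin n) (hs : tropicalRank A < s) :
    ∃ x : Fin s → ℝ, ∀ i j, ∃ k, k ≠ j ∧ A i (g k) + x k ≤ A i (g j) + x j := by
  rcases exists_solution_or_exists_unique_optimum fun i j => A i (g j) with h | ⟨σ, hσ, h⟩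
  · exact h
  · exact absurd hs (not_lt.2 (le_tropicalRank ⟨σ, hσ⟩ g
      (not_isTropicallySingular_of_unique_optimum h)))

/-- The first `r` columns of an `n`-column matrix together with one further column. -/
def prefixWith {n r : ℕ} (k : Fin n) (hk : r ≤ k) : Fin (r + 1) ↪ Fin n where
  toFun := Fin.lastCases k fun t => ⟨t, t.2.trans_le (hk.trans k.2.le)⟩
  inj' := by
    intro a b
    refine Fin.lastCases ?_ (fun s => ?_) a <;> refine Fin.lastCases ?_ (fun t => ?_) b
    · simp
    · simp only [Fin.lastCases_last, Fin.lastCases_castSucc]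
      intro h
      have := congrArg Fin.val h
      simp at this
      omega
    · simp only [Fin.lastCases_last, Fin.lastCases_castSucc]
      intro h
      have := congrArg Fin.val h
      simp at this
      omega
    · simp [Fin.ext_iff]

@[simp]
theorem prefixWith_last {n r : ℕ} (k : Fin n) (hk : r ≤ k) : prefixWith k hk (Fin.last r) = k :=
  Fin.lastCases_last (motive := fun _ => Fin n)

@[simp]
theorem prefixWith_castSucc_val {n r : ℕ} (k : Fin n) (hk : r ≤ k) (t : Fin r) :
    (prefixWith k hk t.castSucc : ℕ) = t :=
  congrArg Fin.val (Fin.lastCases_castSucc (motive := fun _ => Fin n) t)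

/-- The coordinates beyond the tropical rank of a point of the prevariety are arbitrary. -/
theorem exists_mem_prevariety_extending {m n r : ℕ} (A : Matrix (Fin m) (Fin n) ℝ)
    (hA : tropicalRank A ≤ r) (hr : r < n) (v : {j : Fin n // r ≤ j} → ℝ) :
    ∃ z ∈ prevariety A, ∀ j : {j : Fin n // r ≤ j}, z j = v j := by
  have : NeZero n := ⟨by omega⟩
  have : Nonempty {j : Fin n // r ≤ j} := ⟨⟨⟨r, hr⟩, le_rfl⟩⟩
  choose x hx using fun k : {j : Fin n // r ≤ j} =>
    exists_solution_of_tropicalRank_lt A (prefixWith k.1 k.2) (by omega)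
  -- Solution `k`, shifted to take the value `v k` at column `k`; `z` is the minimum of these, each
  -- regarded as `+∞` outside its own columns.
  set b : Fin r → {j : Fin n // r ≤ j} → ℝ :=
    fun t k => v k - x k (Fin.last r) + x k t.castSucc with hb
  choose q hq using fun t => Finite.exists_min (b t)
  set z : Fin n → ℝ := fun j => if h : r ≤ j then v ⟨j, h⟩
    else b ⟨j, not_le.1 h⟩ (q ⟨j, not_le.1 h⟩) with hz
  have z_le : ∀ k t, z (prefixWith k.1 k.2 t) ≤ v k - x k (Fin.last r) + x k t := by
    intro k t
    refine Fin.lastCases ?_ (fun t => ?_) t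
    · simp [hz, k.2]
    · have hlt : ¬ r ≤ (prefixWith k.1 k.2 t.castSucc : ℕ) := by simp
      simp only [hz, dif_neg hlt, prefixWith_castSucc_val]
      exact hq t k
  have z_eq : ∀ j, ∃ k t, prefixWith k.1 k.2 t = j ∧ z j = v k - x k (Fin.last r) + x k t := by
    intro j
    by_cases hj : r ≤ j
    · exact ⟨⟨j, hj⟩, Fin.last r, by simp, by simp [hz, hj]⟩
    · refine ⟨q ⟨j, not_le.1 hj⟩, Fin.castSucc ⟨j, not_le.1 hj⟩,
        Fin.ext (prefixWith_castSucc_val _ _ _), ?_⟩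
      simp only [hz, dif_neg hj, hb]
  refine ⟨z, mem_prevariety_of_forall_exists_ne fun i j => ?_, fun j => by simp [hz, j.2]⟩
  -- Solution `k` realizes `z` at `j`, so its competing column still competes: there `z` can only be
  -- smaller.
  obtain ⟨k, t, rfl, hzt⟩ := z_eq j
  obtain ⟨s, hs, hle⟩ := hx k i t
  exact ⟨_, (prefixWith k.1 k.2).injective.ne hs, by linarith [z_le k s]⟩

/-! ### Polyhedral pieces and the dimension inequality -/

theorem isPolyhedron_setOf_forall {ι : Type*} [Finite ι] {n : ℕ} (B : ι → Fin n → ℝ) (c : ι → ℝ) :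
    IsPolyhedron {x : Fin n → ℝ | ∀ i, B i ⬝ᵥ x ≤ c i} := by
  obtain ⟨k, ⟨e⟩⟩ := Finite.exists_equiv_fin ι
  refine ⟨k, fun i => B (e.symm i), fun i => c (e.symm i), Set.ext fun x => ?_⟩
  exact (e.symm.forall_congr_right (q := fun i => B i ⬝ᵥ x ≤ c i)).symm

/-- Solution sets of finitely many difference constraints are polyhedra. -/
theorem isPolyhedron_difference {ι : Type*} [Finite ι] {n : ℕ} (p q : ι → Fin n) (c : ι → ℝ) :
    IsPolyhedron {x : Fin n → ℝ | ∀ i, x (p i) - x (q i) ≤ c i} := by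
  have h := isPolyhedron_setOf_forall (fun i => Pi.single (p i) 1 - Pi.single (q i) 1) c
  simpa only [sub_dotProduct, single_dotProduct, one_mul] using h

/-- The part of the prevariety where the minimum in row `i` is attained in the columns `p i`. -/
def prevarietyPiece {m n : ℕ} (A : Matrix (Fin m) (Fin n) ℝ) (p : Fin m → Fin n × Fin n) :
    Set (Fin n → ℝ) :=
  {x | ∀ i j, A i (p i).1 + x (p i).1 ≤ A i j + x j ∧ A i (p i).2 + x (p i).2 ≤ A i j + x j}

theorem isPolyhedron_prevarietyPiece {m n : ℕ} (A : Matrix (Fin m) (Fin n) ℝ)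
    (p : Fin m → Fin n × Fin n) : IsPolyhedron (prevarietyPiece A p) := by
  convert! isPolyhedron_difference
    (fun t : Fin m × Fin n × Bool => if t.2.2 then (p t.1).1 else (p t.1).2)
    (fun t => t.2.1)
    (fun t => A t.1 t.2.1 - A t.1 (if t.2.2 then (p t.1).1 else (p t.1).2)) using 1
  ext x
  simp only [prevarietyPiece, Set.mem_ofPred_eq, Prod.forall, Bool.forall_bool]
  refine forall₂_congr fun i j => ?_
  simp only [if_true, Bool.false_eq_true, if_false]
  constructor
  · rintro ⟨h1, h2⟩
    constructor <;> linarith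
  · rintro ⟨h1, h2⟩
    constructor <;> linarith

theorem prevarietyPiece_subset {m n : ℕ} (A : Matrix (Fin m) (Fin n) ℝ)
    {p : Fin m → Fin n × Fin n} (hp : ∀ i, (p i).1 < (p i).2) :
    prevarietyPiece A p ⊆ prevariety A := fun _ hx i =>
  ⟨(p i).1, (p i).2, hp i, le_antisymm (hx i _).1 (hx i _).2, fun j => (hx i j).1⟩

theorem exists_mem_prevarietyPiece {m n : ℕ} {A : Matrix (Fin m) (Fin n) ℝ} {x : Fin n → ℝ}
    (hx : x ∈ prevariety A) :
    ∃ p : Fin m → Fin n × Fin n, (∀ i, (p i).1 < (p i).2) ∧ x ∈ prevarietyPiece A p := by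
  choose k l hkl heq hmin using hx
  exact ⟨fun i => (k i, l i), hkl, fun i j => ⟨hmin i j, heq i ▸ hmin i j⟩⟩

/-- A set whose image under a linear map is not a null set has at least the dimension of the
target. -/
theorem card_le_affineDim_of_volume_image_ne_zero {ι : Type*} [Fintype ι] {n : ℕ}
    {P : Set (Fin n → ℝ)} (f : (Fin n → ℝ) →ₗ[ℝ] (ι → ℝ))
    (h : MeasureTheory.volume (f '' P) ≠ 0) : Fintype.card ι ≤ affineDim P := by
  have hspan : (affineSpan ℝ P).map f.toAffineMap = ⊤ := by
    by_contra hne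
    refine h (MeasureTheory.measure_mono_null ?_
      (MeasureTheory.Measure.addHaar_affineSubspace MeasureTheory.volume _ hne))
    rw [AffineSubspace.map_span]
    exact subset_affineSpan ℝ _
  have hdir : (affineSpan ℝ P).direction.map f = ⊤ := by
    rw [← AffineSubspace.direction_top ℝ (ι → ℝ) (ι → ℝ), ← hspan, AffineSubspace.map_direction]
    rfl
  calc Fintype.card ι = Module.finrank ℝ (⊤ : Submodule ℝ (ι → ℝ)) := by simp
    _ = Module.finrank ℝ ((affineSpan ℝ P).direction.map f) := by rw [hdir]
    _ ≤ affineDim P := Submodule.finrank_map_le _ _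

/-- The projections of finitely many polyhedral pieces cover the whole coordinate space, so they
cannot all be null sets. -/
theorem sub_tropicalRank_le_tropicalDimension {m n : ℕ} (A : Matrix (Fin m) (Fin n) ℝ) :
    n - tropicalRank A ≤ tropicalDimension A := by
  rcases le_or_gt n (tropicalRank A) with hle | hlt
  · omega
  set f : (Fin n → ℝ) →ₗ[ℝ] ({j : Fin n // tropicalRank A ≤ j} → ℝ) :=
    LinearMap.funLeft ℝ ℝ Subtype.val
  have hcover : (Set.univ : Set ({j : Fin n // tropicalRank A ≤ j} → ℝ)) ⊆
      ⋃ p : {p : Fin m → Fin n × Fin n // ∀ i, (p i).1 < (p i).2},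
        f '' prevarietyPiece A p.1 := by
    intro v _
    obtain ⟨z, hz, hzv⟩ := exists_mem_prevariety_extending A le_rfl hlt v
    obtain ⟨p, hp, hzp⟩ := exists_mem_prevarietyPiece hz
    exact Set.mem_iUnion.2 ⟨⟨p, hp⟩, z, hzp, funext hzv⟩
  obtain ⟨p, hp⟩ : ∃ p : {p : Fin m → Fin n × Fin n // ∀ i, (p i).1 < (p i).2},
      MeasureTheory.volume (f '' prevarietyPiece A p.1) ≠ 0 := by
    by_contra! hnull
    exact isOpen_univ.measure_ne_zero MeasureTheory.volume Set.univ_nonempty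
      (MeasureTheory.measure_mono_null hcover (MeasureTheory.measure_iUnion_null hnull))
  calc n - tropicalRank A = Fintype.card {j : Fin n // tropicalRank A ≤ j} := by
        rw [Fintype.card_subtype]
        have h := Fin.card_Ici (⟨tropicalRank A, hlt⟩ : Fin n)
        rw [← h]
        congr 1
        ext j
        simp [Fin.le_def]
    _ ≤ affineDim (prevarietyPiece A p.1) := card_le_affineDim_of_volume_image_ne_zero f hp
    _ ≤ tropicalDimension A := affineDim_le_tropicalDimension
        (isPolyhedron_prevarietyPiece A p.1) (prevarietyPiece_subset A p.2)

/-! ### The tight example -/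

theorem prevariety_tight_example :
    prevariety !![(1 : ℝ), 0, 0; 0, 1, 0] = {x | ∃ c : ℝ, x = fun _ => c} := by
  ext x
  constructor
  · intro h
    obtain ⟨k, l, hkl, heq, hmin⟩ := h 0
    obtain ⟨k', l', hkl', heq', hmin'⟩ := h 1
    have m0 := hmin 0
    have m1 := hmin 1
    have m2 := hmin 2
    have m0' := hmin' 0
    have m1' := hmin' 1
    have m2' := hmin' 2
    have key : x 0 = x 2 ∧ x 1 = x 2 := by
      fin_cases k <;> fin_cases l <;> first | exact absurd hkl (by decide) | skip
      all_goals
        fin_cases k' <;> fin_cases l' <;> first | exact absurd hkl' (by decide) | skip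
      all_goals
        simp at heq heq' m0 m1 m2 m0' m1' m2'
        constructor <;> linarith
    refine ⟨x 2, funext fun j => ?_⟩
    fin_cases j
    · exact key.1
    · exact key.2
    · rfl
  · rintro ⟨c, rfl⟩ i
    fin_cases i
    · refine ⟨1, 2, by decide, by simp, fun j => ?_⟩
      fin_cases j <;> simp
    · refine ⟨0, 2, by decide, by simp, fun j => ?_⟩
      fin_cases j <;> simp

theorem tropicalRank_tight_example : tropicalRank !![(1 : ℝ), 0, 0; 0, 1, 0] = 2 := by
  refine le_antisymm (tropicalRank_le_rows _) (le_tropicalRank (Function.Embedding.refl _)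
    -- Columns in the order 1, 0 put the zeros on the diagonal, so the identity costs 0 and the swap
    -- 2.
    ⟨![1, 0], by decide⟩ (not_isTropicallySingular_of_unique_optimum fun τ hτ => ?_))
  have hswap : τ = Equiv.swap 0 1 := by
    revert τ
    decide
  subst hswap
  simp [Fin.sum_univ_two]

/-- A linear subspace containing the prevariety bounds the tropical dimension. -/
theorem tropicalDimension_le_finrank {m n : ℕ} {A : Matrix (Fin m) (Fin n) ℝ}
    (W : Submodule ℝ (Fin n → ℝ)) (h : prevariety A ⊆ W) :
    tropicalDimension A ≤ Module.finrank ℝ W := by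
  refine csSup_le (tropicalDimension_set A).1 ?_
  rintro d ⟨P, -, hP, rfl⟩
  refine Submodule.finrank_mono ?_
  rw [← Submodule.toAffineSubspace_direction W]
  exact AffineSubspace.direction_le (affineSpan_le.2 (hP.trans h))

theorem tropicalDimension_tight_example :
    tropicalDimension !![(1 : ℝ), 0, 0; 0, 1, 0] = 1 := by
  refine le_antisymm ?_ ?_
  · refine (tropicalDimension_le_finrank (Submodule.span ℝ {fun _ => 1}) ?_).trans
      (finrank_span_singleton (by simp [funext_iff])).le
    rw [prevariety_tight_example]
    rintro x ⟨c, rfl⟩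
    exact Submodule.mem_span_singleton.2 ⟨c, by ext; simp⟩
  · have := sub_tropicalRank_le_tropicalDimension !![(1 : ℝ), 0, 0; 0, 1, 0]
    rw [tropicalRank_tight_example] at this
    exact this

/-! ### The codimension bound and the strict example -/

/-- A hyperplane `x k - x l = c` with `k ≠ l` is a null set. -/
theorem volume_difference_eq_zero {n : ℕ} {k l : Fin n} (hkl : k ≠ l) (c : ℝ) :
    MeasureTheory.volume {x : Fin n → ℝ | x k - x l = c} = 0 := by
  let f : (Fin n → ℝ) →ₗ[ℝ] ℝ := LinearMap.proj (R := ℝ) (φ := fun _ : Fin n => ℝ) k - LinearMap.proj l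
  have hf : ∀ x, f x = x k - x l := fun x => rfl
  set S : AffineSubspace ℝ (Fin n → ℝ) :=
    (AffineSubspace.mk' c (⊥ : Submodule ℝ ℝ)).comap f.toAffineMap with hS
  have hmem : ∀ x, x ∈ S ↔ x k - x l = c := fun x => by
    simp [hS, AffineSubspace.mem_comap, AffineSubspace.mem_mk', hf, sub_eq_zero]
  have hne : S ≠ ⊤ := fun htop => by
    have h := (hmem (Pi.single k (c + 1))).1 (htop ▸ AffineSubspace.mem_top ℝ _ _)
    simp [hkl] at h
  refine MeasureTheory.measure_mono_null (fun x hx => (hmem x).2 hx)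
    (MeasureTheory.Measure.addHaar_affineSubspace MeasureTheory.volume S hne)

/-- A nonempty tropical linear system has a lower-dimensional prevariety. -/
theorem tropicalDimension_le_pred {m n : ℕ} (hm : 0 < m) (hn : 0 < n)
    (A : Matrix (Fin m) (Fin n) ℝ) : tropicalDimension A ≤ n - 1 := by
  refine csSup_le (tropicalDimension_set A).1 ?_
  rintro d ⟨P, ⟨s, B, c, hPB⟩, hP, rfl⟩
  -- A full-dimensional convex `P` would have interior of positive measure, yet row 0 confines it to
  -- finitely many hyperplanes `x k - x l = const`.
  by_contra hlt
  have hdir : (affineSpan ℝ P).direction = ⊤ := by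
    apply Submodule.eq_top_of_finrank_eq
    refine le_antisymm (Submodule.finrank_le _) ?_
    rw [Module.finrank_fin_fun]
    unfold affineDim at hlt
    omega
  have hPne : P.Nonempty := by
    rw [Set.nonempty_iff_ne_empty]
    rintro rfl
    rw [AffineSubspace.span_empty, AffineSubspace.direction_bot] at hdir
    have h := congrArg (fun W : Submodule ℝ (Fin n → ℝ) => Module.finrank ℝ W) hdir
    simp only [finrank_bot, finrank_top, Module.finrank_fin_fun] at h
    omega
  have hspan : affineSpan ℝ P = ⊤ :=
    (AffineSubspace.direction_eq_top_iff_of_nonempty ((affineSpan_nonempty ℝ).2 hPne)).1 hdir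
  have hconv : Convex ℝ P := by
    have h : P = ⋂ i, {x | B.mulVecLin x i ≤ c i} := by
      ext x
      simp [hPB]
    rw [h]
    exact convex_iInter fun i => convex_halfSpace_le
      ((LinearMap.proj (R := ℝ) (φ := fun _ : Fin s => ℝ) i ∘ₗ B.mulVecLin).isLinear) (c i)
  have hint := hconv.interior_nonempty_iff_affineSpan_eq_top.2 hspan
  refine isOpen_interior.measure_ne_zero MeasureTheory.volume hint
    (MeasureTheory.measure_mono_null (t := ⋃ p : {p : Fin n × Fin n // p.1 < p.2},
      {x : Fin n → ℝ | x p.1.1 - x p.1.2 = A ⟨0, hm⟩ p.1.2 - A ⟨0, hm⟩ p.1.1}) ?_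
      (MeasureTheory.measure_iUnion_null fun p => volume_difference_eq_zero p.2.ne _))
  intro x hx
  obtain ⟨k, l, hkl, heq, -⟩ := hP (interior_subset hx) ⟨0, hm⟩
  exact Set.mem_iUnion.2 ⟨⟨(k, l), hkl⟩, by simp only [Set.mem_ofPred_eq]; linarith⟩

/-- The first four columns form the indicator of the strict lower triangle: the identity costs 0,
and any other permutation has some `τ i < i`. -/
theorem tropicalRank_strict_example :
    tropicalRank !![(0 : ℝ), 0, 0, 0, 0; 1, 0, 0, 0, 0; 1, 1, 0, 0, 0; 1, 1, 1, 0, 0] = 4 := by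
  refine le_antisymm (tropicalRank_le_rows _) (le_tropicalRank (Function.Embedding.refl _)
    Fin.castSuccEmb (not_isTropicallySingular_of_unique_optimum fun τ hτ => ?_))
  have hentry : ∀ i j : Fin 4,
      (!![(0 : ℝ), 0, 0, 0, 0; 1, 0, 0, 0, 0; 1, 1, 0, 0, 0; 1, 1, 1, 0, 0].submatrix
        (Function.Embedding.refl _) Fin.castSuccEmb) i j = if j < i then 1 else 0 := by
    intro i j
    fin_cases i <;> fin_cases j <;> simp
  simp only [hentry, lt_irrefl, if_false, Finset.sum_const_zero]
  obtain ⟨i, hi⟩ : ∃ i, τ i < i := by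
    revert τ
    decide
  exact Finset.sum_pos' (fun j _ => by split_ifs <;> norm_num) ⟨i, Finset.mem_univ i, by simp [hi]⟩

theorem tropicalDimension_strict_example :
    tropicalDimension !![(0 : ℝ), 0, 0, 0, 0; 1, 0, 0, 0, 0; 1, 1, 0, 0, 0; 1, 1, 1, 0, 0] = 4 := by
  refine le_antisymm (tropicalDimension_le_pred (by norm_num) (by norm_num) _) ?_
  -- Where `x 3` and `x 4` are both minimal, the nonnegative entries and the two zero columns make
  -- columns 3 and 4 attain every row minimum.
  set P : Set (Fin 5 → ℝ) := {x | ∀ j : Fin 5 × Bool,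
    x (if j.2 then 3 else 4) - x j.1 ≤ 0} with hPdef
  have hmem : ∀ x, x ∈ P ↔ ∀ j, x 3 ≤ x j ∧ x 4 ≤ x j := fun x => by
    simp [hPdef, and_comm]
  have hsub : P ⊆ prevariety
      !![(0 : ℝ), 0, 0, 0, 0; 1, 0, 0, 0, 0; 1, 1, 0, 0, 0; 1, 1, 1, 0, 0] := by
    intro x hx
    rw [hmem] at hx
    have h34 : x 3 = x 4 := le_antisymm (hx 4).1 (hx 3).2
    intro i
    have hi : ∀ j, (0 : ℝ) ≤
        !![(0 : ℝ), 0, 0, 0, 0; 1, 0, 0, 0, 0; 1, 1, 0, 0, 0; 1, 1, 1, 0, 0] i j := fun j => by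
      fin_cases i <;> fin_cases j <;> simp
    refine ⟨3, 4, by decide, ?_, fun j => ?_⟩
    · rw [h34]
      fin_cases i <;> simp
    · refine le_trans (le_of_eq ?_) (add_le_add (hi j) (hx j).1)
      fin_cases i <;> simp
  refine le_trans ?_ (affineDim_le_tropicalDimension (isPolyhedron_difference _ _ _) hsub)
  -- `L` parametrizes the hyperplane `x 3 = x 4`. Raising the first three coordinates by a large `c`
  -- moves `L y` into `P`, so `L y` is a difference of two points of `P`.
  let L : (Fin 4 → ℝ) →ₗ[ℝ] (Fin 5 → ℝ) := LinearMap.funLeft ℝ ℝ ![0, 1, 2, 3, 3]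
  have hL : Function.Injective L :=
    LinearMap.funLeft_injective_of_surjective ℝ ℝ _ (by decide)
  have hrange : LinearMap.range L ≤ (affineSpan ℝ P).direction := by
    rintro _ ⟨y, rfl⟩
    obtain ⟨c, hc⟩ : ∃ c : ℝ, ∀ j, |y 3 - y j| ≤ c := by
      obtain ⟨k, hk⟩ := Finite.exists_max fun j => |y 3 - y j|
      exact ⟨_, hk⟩
    have hc0 : 0 ≤ c := (abs_nonneg _).trans (hc 0)
    have hle : ∀ j, y 3 ≤ y j + c := fun j => by linarith [(abs_le.1 (hc j)).2]
    have hq : ![c, c, c, 0, 0] ∈ P := by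
      rw [hmem]
      intro j
      fin_cases j <;> simp [hc0]
    have hp : L y + ![c, c, c, 0, 0] ∈ P := by
      rw [hmem]
      intro j
      fin_cases j <;> simp [L, LinearMap.funLeft_apply, hle]
    have h := AffineSubspace.vsub_mem_direction (subset_affineSpan ℝ P hp)
      (subset_affineSpan ℝ P hq)
    rwa [vsub_eq_sub, add_sub_cancel_right] at h
  calc 4 = Module.finrank ℝ (LinearMap.range L) := by
        rw [LinearMap.finrank_range_of_inj hL]; simp
    _ ≤ affineDim P := Submodule.finrank_mono hrange

end TropicalLinear

theorem mainTheorem10 :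
    (∀ (m n : ℕ) (A : Matrix (Fin m) (Fin n) ℝ),
      (n : ℤ) - (TropicalLinear.tropicalDimension A : ℤ) ≤ (TropicalLinear.tropicalRank A : ℤ)) ∧
    (∃ A : Matrix (Fin 2) (Fin 3) ℝ,
      A = !![1, 0, 0;
             0, 1, 0] ∧
      TropicalLinear.prevariety A = {x | ∃ c : ℝ, x = fun _ => c} ∧
      TropicalLinear.tropicalDimension A = 1 ∧
      TropicalLinear.tropicalRank A = 2 ∧
      (3 : ℤ) - (TropicalLinear.tropicalDimension A : ℤ) = (TropicalLinear.tropicalRank A : ℤ)) ∧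
    (∃ A : Matrix (Fin 4) (Fin 5) ℝ,
      A = !![0, 0, 0, 0, 0;
             1, 0, 0, 0, 0;
             1, 1, 0, 0, 0;
             1, 1, 1, 0, 0] ∧
      TropicalLinear.tropicalDimension A = 4 ∧
      TropicalLinear.tropicalRank A = 4 ∧
      (5 : ℤ) - (TropicalLinear.tropicalDimension A : ℤ) < (TropicalLinear.tropicalRank A : ℤ)) := by
  refine ⟨fun m n A => ?_, ⟨_, rfl, TropicalLinear.prevariety_tight_example,
    TropicalLinear.tropicalDimension_tight_example, TropicalLinear.tropicalRank_tight_example, ?_⟩,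
    ⟨_, rfl, TropicalLinear.tropicalDimension_strict_example,
    TropicalLinear.tropicalRank_strict_example, ?_⟩⟩
  · have := TropicalLinear.sub_tropicalRank_le_tropicalDimension A
    omega
  · rw [TropicalLinear.tropicalDimension_tight_example, TropicalLinear.tropicalRank_tight_example]
    norm_num
  · rw [TropicalLinear.tropicalDimension_strict_example,
      TropicalLinear.tropicalRank_strict_example]
    norm_num
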